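/- Let $X_1,X_2,\dots$ be iid real random variables with law $F$ having density $f$, and let $F_0$ be a target probability law on $\mathbb R$ with density $f_0$ and cdf $F_0(x)$. For each $n$ let $X'_{1},\dots,X'_{n}$ (depending on $n$) be random variables on the same probability space, the augmented data obtained from $X_1,\dots,X_n$. Let ${\cal K}$ be a bounded integrable kernel with $\int{\cal K}=1$, let $h_n>0$ be bandwidths and $e_n>0$ a trimming sequence with $e_n\to0$. For data $z=(z_1,\dots,z_n)$ put $$\widehat f^{\,z}(x)=\frac1{nh_n}\sum_{j=1}^n{\cal K}\Big(\frac{z_j-x}{h_n}\Big),\qquad \widehat f^{\,z}_{e_n}=\max(\widehat f^{\,z},e_n),\qquad \omega_i(z)=\frac{f_0(z_i)}{\widehat f^{\,z}_{e_n}(z_i)},\qquad q_i(z)=\frac{\omega_i(z)}{\sum_{j}\omega_j(z)} .$$ Write $q_i=q_i(X_1,\dots,X_n)$ and $q_i'=q_i(X_1',\dots,X_n')$. The DA-WR algorithm draws one of the $X_i'$ with probabilities $q_i'$, so that its output has, given the data, the cdf $F^{**}(x)=\sum_{i=1}^n q_i'\,\mathbb 1\{X_i'\le x\}$. Let ${\cal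 X}\subseteq\mathbb R$ and assume: (C) for some integer $k\ge1$, $f$ is $k$ times continuously differentiable with bounded $k$-th derivative, ${\cal K}$ is either nonnegative or of order $k$ (that is, $\int|u|^k|{\cal K}(u)|\,du<\infty$ and $\int u^j{\cal K}(u)\,du=0$ for $1\le j<k$), and $h_n^k+\frac{\log n}{nh_n}=O(e_n^2)$; (C') for all $x\in{\cal X}$, $\max_{1\le i\le n}\big|\mathbb 1\{X_i\le x\}-\mathbb 1\{X_i'\le x\}\big|=o(1/n)$ in probability; (C'') $\max_{1\le i\le n}|q_i-q_i'|=o(1/n)$ in probability; and the support of $F$ contains the support of $F_0$, in the sense that $f>0$ at almost every point where $f_0>0$. Then for all $x\in{\cal X}$, $F^{**}(x)$ converges in probability to $F_0(x)$ as $n\to\infty$. -/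

import Mathlib

open MeasureTheory ProbabilityTheory Filter Topology Asymptotics

/-- `g` is a probability density function, with respect to Lebesgue measure, of the law `μ`. -/
structure IsDensityOf (g : ℝ → ℝ) (μ : Measure ℝ) : Prop where
  measurable : Measurable g
  nonneg : ∀ t, 0 ≤ g t
  law_eq : μ = volume.withDensity (fun t => ENNReal.ofReal (g t))

/-- A smoothing kernel: a bounded integrable function with integral one. -/
structure IsKernel (K : ℝ → ℝ) : Prop where
  measurable : Measurable K
  bounded : ∃ C : ℝ, ∀ u, |K u| ≤ C
  integrable : Integrable K
  integral_eq_one : ∫ u, K u = 1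

/-- `K` is of order `k`: its absolute moment of order `k` is finite and its moments of orders
`1, …, k - 1` vanish. -/
structure HasKernelOrder (K : ℝ → ℝ) (k : ℕ) : Prop where
  integrable_moment : Integrable (fun u => |u| ^ k * K u)
  moment_eq_zero : ∀ j : ℕ, 1 ≤ j → j < k → ∫ u, u ^ j * K u = 0

/-- The kernel density estimator with bandwidth `h`, computed from the data `z`, at `x`. -/
noncomputable def kernelEstimator (K : ℝ → ℝ) (h : ℝ) {n : ℕ} (z : Fin n → ℝ) (x : ℝ) : ℝ :=
  1 / ((n : ℝ) * h) * ∑ j, K ((z j - x) / h)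

/-- The kernel density estimator trimmed from below at level `e`. -/
noncomputable def trimmedEstimator (K : ℝ → ℝ) (h e : ℝ) {n : ℕ} (z : Fin n → ℝ) (x : ℝ) : ℝ :=
  max (kernelEstimator K h z x) e

/-- The drawing weight `ω_i` of the `i`-th data point. -/
noncomputable def drawWeight (K f₀ : ℝ → ℝ) (h e : ℝ) {n : ℕ} (z : Fin n → ℝ) (i : Fin n) : ℝ :=
  f₀ (z i) / trimmedEstimator K h e z (z i)

/-- The normalized drawing weight `q_i` of the `i`-th data point. -/
noncomputable def normWeight (K f₀ : ℝ → ℝ) (h e : ℝ) {n : ℕ} (z : Fin n → ℝ) (i : Fin n) : ℝ :=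
  drawWeight K f₀ h e z i / ∑ j, drawWeight K f₀ h e z j

/-- The indicator of `t ≤ x`. -/
noncomputable def indLE (x t : ℝ) : ℝ := (Set.Iic x).indicator 1 t

/-- The cdf at `x`, given the data `z`, of a point drawn by weighted resampling from `z`. -/
noncomputable def resamplingCdf (K f₀ : ℝ → ℝ) (h e : ℝ) {n : ℕ} (z : Fin n → ℝ) (x : ℝ) : ℝ :=
  ∑ i, normWeight K f₀ h e z i * indLE x (z i)

/-- `Z n = o(r n)` in probability. -/
def IsLittleOInProb {Ω : Type*} [MeasurableSpace Ω] (P : Measure Ω) (Z : ℕ → Ω → ℝ)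
    (r : ℕ → ℝ) : Prop :=
  TendstoInMeasure P (fun n ω => Z n ω / r n) atTop (fun _ => 0)

/-- The first `n` observations. -/
def sample {Ω : Type*} (X : ℕ → Ω → ℝ) (n : ℕ) (ω : Ω) : Fin n → ℝ := fun i => X i ω

/-! The cdf drawn from the augmented data differs from the one drawn from the original data by at
most `n * max |q_i - q'_i|` plus the largest difference of indicators (`abs_resamplingCdf_sub_le`),
which vanishes in probability by (C') and (C''). It remains to treat the original data. There the
cdf is the ratio of the means of `ω_i 1{X_i ≤ x}` and of `ω_i`. If `ω_i` were the exact importance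
weight `f₀(X_i)/f(X_i)`, the law of large numbers would give the limits `F₀(x)` and `1`.

The replacement of `ω_i` by the exact weight is made in mean, not uniformly in the data point. Let
`g_n` be the expectation of the kernel estimator. Everything rests on the inequality `f ≤ C max(g_n,
e_n)`, which cancels the small denominators of the weights after integration against `f` and leaves
the integrable function `f₀`.

Random part: given `X_i = t`, the other observations are still iid, and the estimator deviates from
`g_n(t)` in mean by `O((n h_n)⁻¹ + (n h_n)^(-1/2))`. Trimming costs a factor `1/e_n`, and the
bandwidth condition makes the product vanish (`lintegral_weight_mul_deviation_le`).

Deterministic part: `g_n → f` pointwise, and the errors `f |f₀/max(g_n, e_n) - f₀/f|` are dominated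
by a multiple of `f₀` (`tendsto_lintegral_weight_sub`).

The key inequality follows from the bias bound for a kernel of order `k`. For a nonnegative kernel
no moments are available. Instead, `f` is locally a polynomial up to `O(h^k)`, and the value of a
polynomial of bounded degree at a point is controlled by its `L¹` norm on a set of positive measure
where the kernel is bounded below. -/

/-! ### Pointwise control of a smooth function by local averages. -/

/-- Taylor's theorem with a bound on the remainder, on both sides of the base point. -/
theorem abs_sub_taylor_le {f : ℝ → ℝ} {k : ℕ} (hk : 1 ≤ k) (hf : ContDiff ℝ k f) {M : ℝ}
    (hM : ∀ t, |iteratedDeriv k f t| ≤ M) (x v : ℝ) :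
    |f (x + v) - ∑ j ∈ Finset.range k, iteratedDeriv j f x / j.factorial * v ^ j|
      ≤ M * |v| ^ k := by
  obtain ⟨n, rfl⟩ : ∃ n, k = n + 1 := ⟨k - 1, by omega⟩
  have hM0 : 0 ≤ M := (abs_nonneg _).trans (hM 0)
  -- The Lagrange remainder needs two distinct endpoints.
  rcases eq_or_ne v 0 with rfl | hv
  · rw [Finset.sum_range_succ']
    simp
  have hne : x ≠ x + v := by simpa using hv
  have hf' : ContDiffOn ℝ (n + 1) f (Set.uIcc x (x + v)) := by
    exact_mod_cast hf.contDiffOn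
  obtain ⟨y, -, hy⟩ := taylor_mean_remainder_lagrange_iteratedDeriv hne hf'
  have hT : taylorWithinEval f n (Set.uIcc x (x + v)) x (x + v)
      = ∑ j ∈ Finset.range (n + 1), iteratedDeriv j f x / j.factorial * v ^ j := by
    rw [taylor_within_apply]
    refine Finset.sum_congr rfl fun j hj => ?_
    rw [iteratedDerivWithin_eq_iteratedDeriv (uniqueDiffOn_uIcc hne) _ Set.left_mem_uIcc]
    · simp only [smul_eq_mul, add_sub_cancel_left]
      ring
    · refine (hf.of_le ?_).contDiffAt
      exact_mod_cast (Finset.mem_range.1 hj).le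
  rw [← hT, hy, add_sub_cancel_left, abs_div, abs_mul, abs_pow]
  have hfac : (1 : ℝ) ≤ |((n + 1).factorial : ℝ)| := by
    rw [Nat.abs_cast]
    exact_mod_cast Nat.one_le_iff_ne_zero.2 (Nat.factorial_ne_zero _)
  calc _ ≤ |iteratedDeriv (n + 1) f y| * |v| ^ (n + 1) := div_le_self (by positivity) hfac
    _ ≤ _ := by gcongr; exact hM y

theorem Continuous.integrableOn_of_abs_le {g : ℝ → ℝ} (hg : Continuous g) {A : Set ℝ} {R : ℝ}
    (hR : ∀ u ∈ A, |u| ≤ R) : IntegrableOn g A :=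
  (hg.integrableOn_Icc (a := -R) (b := R)).mono_set fun u hu => abs_le.1 (hR u hu)

/-- On a set of positive measure, the `L¹` norm of a polynomial controls its constant term. -/
theorem exists_abs_le_integral_abs_polynomial {A : Set ℝ} {R : ℝ}
    (hR : ∀ u ∈ A, |u| ≤ R) (hpos : volume A ≠ 0) {k : ℕ} (hk : 1 ≤ k) :
    ∃ C : ℝ, 0 ≤ C ∧ ∀ a : ℕ → ℝ,
      |a 0| ≤ C * ∫ u in A, |∑ j ∈ Finset.range k, a j * u ^ j| := by
  have hint : ∀ a : Fin k → ℝ, Integrable (fun u => ∑ j, a j * u ^ (j : ℕ))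
      (volume.restrict A) := fun a =>
    Continuous.integrableOn_of_abs_le (by fun_prop) hR
  -- The map from coefficients to `L¹(A)` is injective, since a nonzero polynomial has finitely many
  -- roots and `A` is not null. An injective linear map on a finite-dimensional space is bounded
  -- below; this gives `C`.
  let L : (Fin k → ℝ) →ₗ[ℝ] Lp ℝ 1 (volume.restrict A) :=
    { toFun := fun a => (hint a).toL1 _
      map_add' := fun a b => by
        rw [← Integrable.toL1_add]
        congr 1
        ext u
        simp [add_mul, Finset.sum_add_distrib]
      map_smul' := fun c a => by
        rw [RingHom.id_apply, ← Integrable.toL1_smul]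
        congr 1
        ext u
        simp [Finset.mul_sum, mul_assoc] }
  have hker : LinearMap.ker L = ⊥ := by
    rw [LinearMap.ker_eq_bot']
    intro a ha
    have ha' : (fun u => ∑ j, a j * u ^ (j : ℕ)) =ᵐ[volume.restrict A] 0 :=
      (hint a).coeFn_toL1.symm.trans ((Lp.ext_iff.1 ha).trans (Lp.coeFn_zero ℝ 1 _))
    let p : Polynomial ℝ := ∑ j : Fin k, Polynomial.C (a j) * Polynomial.X ^ (j : ℕ)
    have hp : p = 0 := by
      by_contra hp
      refine hpos ?_
      have hfin : volume (p.rootSet ℝ) = 0 := (p.rootSet_finite ℝ).measure_zero _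
      have hroot : ∀ᵐ u ∂volume.restrict A, u ∈ p.rootSet ℝ := by
        filter_upwards [ha'] with u hu
        rw [Polynomial.mem_rootSet]
        refine ⟨hp, ?_⟩
        simpa [p, Polynomial.eval_finsetSum] using hu
      have hnot : ∀ᵐ u ∂volume.restrict A, u ∉ p.rootSet ℝ :=
        ae_restrict_of_ae (measure_eq_zero_iff_ae_notMem.1 hfin)
      have hF : ∀ᵐ u ∂volume.restrict A, False := by
        filter_upwards [hroot, hnot] with u h1 h2 using h2 h1
      rw [eventually_false_iff_eq_bot, ae_eq_bot, Measure.restrict_eq_zero] at hF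
      exact hF
    ext i
    have := congrArg (fun q => Polynomial.coeff q (i : ℕ)) hp
    simpa [p, Polynomial.finsetSum_coeff, Polynomial.coeff_X_pow, Fin.val_inj] using this
  obtain ⟨C, -, hC⟩ := L.exists_antilipschitzWith hker
  refine ⟨C, C.2, fun a => ?_⟩
  have h1 := hC.le_mul_dist (fun i : Fin k => a i) 0
  rw [map_zero, dist_zero_right, dist_zero_right] at h1
  have h2 : ‖L fun i : Fin k => a i‖ = ∫ u in A, |∑ j ∈ Finset.range k, a j * u ^ j| := by
    change ‖(hint fun i : Fin k => a i).toL1 _‖ = _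
    rw [L1.norm_eq_integral_norm]
    refine integral_congr_ae ?_
    filter_upwards [(hint fun i : Fin k => a i).coeFn_toL1] with u hu
    rw [hu, Real.norm_eq_abs, Finset.sum_range]
  rw [h2] at h1
  exact (norm_le_pi_norm (fun i : Fin k => a i) ⟨0, hk⟩).trans h1

/-- A function with bounded `k`-th derivative is controlled at each point, up to `O(h ^ k)`, by its
averages at scale `h` near this point. -/
theorem exists_abs_le_setIntegral_abs {f : ℝ → ℝ} {k : ℕ} (hk : 1 ≤ k) (hf : ContDiff ℝ k f)
    {M : ℝ} (hM : ∀ t, |iteratedDeriv k f t| ≤ M) {A : Set ℝ} {R : ℝ}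
    (hA : MeasurableSet A) (hR : ∀ u ∈ A, |u| ≤ R) (hpos : volume A ≠ 0) :
    ∃ C : ℝ, 0 ≤ C ∧ ∀ x h : ℝ, 0 ≤ h → |f x| ≤ C * ((∫ u in A, |f (x + h * u)|) + h ^ k) := by
  obtain ⟨C, hC0, hC⟩ := exists_abs_le_integral_abs_polynomial hR hpos hk
  have hM0 : 0 ≤ M := (abs_nonneg _).trans (hM 0)
  have hfin : volume A ≠ ⊤ := by
    refine ne_top_of_le_ne_top ?_ (measure_mono (t := Set.Icc (-R) R)
      fun u hu => abs_le.1 (hR u hu))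
    simp
  have hR0 : 0 ≤ R := by
    obtain ⟨u, hu⟩ := nonempty_of_measure_ne_zero hpos
    exact (abs_nonneg _).trans (hR u hu)
  set D := M * R ^ k * volume.real A
  have hD : 0 ≤ D := by positivity
  have hfc := hf.continuous
  refine ⟨C * (1 + D), by positivity, fun x h hh => ?_⟩
  -- These are the coefficients of the Taylor polynomial of `u ↦ f (x + h * u)` at `0`, whose
  -- constant term is `f x`.
  have h1 := hC fun j => iteratedDeriv j f x / j.factorial * h ^ j
  simp only [iteratedDeriv_zero, Nat.factorial_zero, Nat.cast_one, div_one, pow_zero,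
    mul_one] at h1
  have h2 : ∫ u in A, |∑ j ∈ Finset.range k, iteratedDeriv j f x / j.factorial * h ^ j * u ^ j|
      ≤ ∫ u in A, (|f (x + h * u)| + M * (h * R) ^ k) := by
    refine setIntegral_mono_on (Continuous.integrableOn_of_abs_le (by fun_prop) hR)
      (Continuous.integrableOn_of_abs_le (by fun_prop) hR) hA fun u hu => ?_
    have h3 := abs_sub_taylor_le hk hf hM x (h * u)
    have h4 : M * |h * u| ^ k ≤ M * (h * R) ^ k := by
      rw [abs_mul, abs_of_nonneg hh]
      gcongr
      exact hR u hu
    simp only [mul_pow, ← mul_assoc] at h3 h4 ⊢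
    rw [abs_sub_comm] at h3
    have h5 := abs_sub_abs_le_abs_sub
      (∑ j ∈ Finset.range k, iteratedDeriv j f x / j.factorial * h ^ j * u ^ j) (f (x + h * u))
    linarith
  rw [integral_add (Continuous.integrableOn_of_abs_le (by fun_prop) hR)
    (Continuous.integrableOn_of_abs_le (by fun_prop) hR), setIntegral_const, smul_eq_mul] at h2
  have h6 : 0 ≤ ∫ u in A, |f (x + h * u)| := integral_nonneg fun u => abs_nonneg _
  have h7 : volume.real A * (M * (h * R) ^ k) = D * h ^ k := by
    simp only [D, mul_pow]; ring
  rw [h7] at h2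
  calc |f x| ≤ C * ((∫ u in A, |f (x + h * u)|) + D * h ^ k) := h1.trans (by gcongr)
    _ ≤ C * ((1 + D) * ((∫ u in A, |f (x + h * u)|) + h ^ k)) := by
      gcongr
      nlinarith [mul_nonneg hD h6, pow_nonneg hh k]
    _ = _ := by ring

/-! ### Integration against a density, and boundedness of smooth densities. -/

namespace IsDensityOf

variable {g : ℝ → ℝ} {μ : Measure ℝ}

theorem lintegral_eq (hg : IsDensityOf g μ) {φ : ℝ → ENNReal} (hφ : Measurable φ) :
    ∫⁻ t, φ t ∂μ = ∫⁻ t, ENNReal.ofReal (g t) * φ t := by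
  rw [hg.law_eq, lintegral_withDensity_eq_lintegral_mul _ hg.measurable.ennreal_ofReal hφ]
  rfl

theorem lintegral_eq_one (hg : IsDensityOf g μ) [IsProbabilityMeasure μ] :
    ∫⁻ t, ENNReal.ofReal (g t) = 1 := by
  have := hg.lintegral_eq (φ := fun _ => 1) measurable_const
  simpa using this.symm

theorem integrable (hg : IsDensityOf g μ) [IsProbabilityMeasure μ] : Integrable g := by
  refine ⟨hg.measurable.aestronglyMeasurable, ?_⟩
  rw [hasFiniteIntegral_iff_ofReal (ae_of_all _ hg.nonneg), hg.lintegral_eq_one]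
  exact ENNReal.one_lt_top

theorem integral_eq (hg : IsDensityOf g μ) (φ : ℝ → ℝ) : ∫ t, φ t ∂μ = ∫ t, g t * φ t := by
  rw [hg.law_eq, integral_withDensity_eq_integral_toReal_smul hg.measurable.ennreal_ofReal
    (ae_of_all _ fun _ => ENNReal.ofReal_lt_top)]
  simp [ENNReal.toReal_ofReal (hg.nonneg _)]

/-- A density with a bounded derivative of some order is bounded. -/
theorem exists_le (hg : IsDensityOf g μ) [IsProbabilityMeasure μ] {k : ℕ} (hk : 1 ≤ k)
    (hgk : ContDiff ℝ k g) {M : ℝ} (hM : ∀ t, |iteratedDeriv k g t| ≤ M) :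
    ∃ B : ℝ, 0 ≤ B ∧ ∀ t, g t ≤ B := by
  -- Averages over intervals of length one are at most the total mass of the density.
  obtain ⟨C, hC0, hC⟩ := exists_abs_le_setIntegral_abs hk hgk hM (A := Set.Icc 0 1) (R := 1)
    measurableSet_Icc (fun u hu => by rw [abs_of_nonneg hu.1]; exact hu.2) (by simp)
  refine ⟨C * ((∫ t, g t) + 1), mul_nonneg hC0
    (add_nonneg (integral_nonneg hg.nonneg) zero_le_one), fun t => ?_⟩
  have h1 := hC t 1 zero_le_one
  simp only [one_mul, one_pow] at h1
  refine (le_abs_self _).trans (h1.trans ?_)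
  gcongr
  calc ∫ u in Set.Icc 0 1, |g (t + u)| ≤ ∫ u, |g (t + u)| :=
        setIntegral_le_integral (hg.integrable.comp_add_left t).abs
          (ae_of_all _ fun u => abs_nonneg _)
    _ = ∫ u, g u := by
        rw [integral_add_left_eq_self (fun u => |g u|)]
        simp [abs_of_nonneg (hg.nonneg _)]

end IsDensityOf

/-! ### Mean of the kernel estimator. -/

/-- The expectation at `t` of the kernel density estimator with bandwidth `h`, for observations
with density `f`. -/
noncomputable def kernelMean (K f : ℝ → ℝ) (h t : ℝ) : ℝ := ∫ u, K u * f (t + h * u)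

section KernelMean

variable {K f : ℝ → ℝ} {B M : ℝ} {k : ℕ}

theorem IsKernel.integrable_mul (hK : IsKernel K) (hf : Continuous f) (hf0 : ∀ t, 0 ≤ f t)
    (hfB : ∀ t, f t ≤ B) (h t : ℝ) : Integrable fun u => K u * f (t + h * u) := by
  refine hK.integrable.mul_bdd (c := B)
    (Continuous.aestronglyMeasurable (by fun_prop)) (ae_of_all _ fun u => ?_)
  rw [Real.norm_eq_abs, abs_of_nonneg (hf0 _)]
  exact hfB _

/-- Consistency in mean of the kernel density estimator. -/
theorem IsKernel.tendsto_kernelMean (hK : IsKernel K) (hf : Continuous f) (hf0 : ∀ t, 0 ≤ f t)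
    (hfB : ∀ t, f t ≤ B) {h : ℕ → ℝ} (hh : Tendsto h atTop (𝓝 0)) (t : ℝ) :
    Tendsto (fun n => kernelMean K f (h n) t) atTop (𝓝 (f t)) := by
  have h1 : f t = ∫ u, K u * f t := by
    rw [integral_mul_const, hK.integral_eq_one, one_mul]
  rw [h1]
  refine tendsto_integral_of_dominated_convergence (fun u => |K u| * B)
    (fun n => (hK.integrable_mul hf hf0 hfB (h n) t).aestronglyMeasurable)
    (hK.integrable.abs.mul_const B) (fun n => ae_of_all _ fun u => ?_)
    (ae_of_all _ fun u => ?_)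
  · rw [Real.norm_eq_abs, abs_mul, abs_of_nonneg (hf0 _)]
    exact mul_le_mul_of_nonneg_left (hfB _) (abs_nonneg _)
  · refine Tendsto.const_mul _ ?_
    have h2 : Tendsto (fun n => t + h n * u) atTop (𝓝 (t + 0 * u)) :=
      tendsto_const_nhds.add (hh.mul_const u)
    have h3 := (hf.tendsto _).comp h2
    simpa [Function.comp_def] using h3

/-- The bias of the kernel density estimator for a kernel of order `k`. -/
theorem HasKernelOrder.abs_kernelMean_sub_le (hK : IsKernel K) (hKk : HasKernelOrder K k)
    (hk : 1 ≤ k) (hfk : ContDiff ℝ k f) (hM : ∀ t, |iteratedDeriv k f t| ≤ M)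
    (hf0 : ∀ t, 0 ≤ f t) (hfB : ∀ t, f t ≤ B) {h : ℝ} (hh : 0 ≤ h) (t : ℝ) :
    |kernelMean K f h t - f t| ≤ M * (∫ u, |u| ^ k * |K u|) * h ^ k := by
  have hmom : ∀ j < k, Integrable fun u => u ^ j * K u := by
    intro j hj
    refine (hK.integrable.abs.add hKk.integrable_moment.abs).mono'
      ((measurable_id.pow_const j).mul hK.measurable).aestronglyMeasurable
      (ae_of_all _ fun u => ?_)
    have h1 : |u| ^ j ≤ 1 + |u| ^ k := by
      rcases le_total |u| 1 with h | h
      · linarith [pow_le_one₀ (n := j) (abs_nonneg u) h, pow_nonneg (abs_nonneg u) k]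
      · linarith [pow_le_pow_right₀ h hj.le]
    simp only [Pi.add_apply, Real.norm_eq_abs, abs_mul, abs_pow, abs_abs]
    nlinarith [abs_nonneg (K u)]
  -- The vanishing moments kill every Taylor term except `j = 0`, so that only the remainder
  -- contributes to the bias.
  have hsum : ∫ u, (∑ j ∈ Finset.range k, iteratedDeriv j f t / j.factorial * h ^ j *
      (u ^ j * K u)) = f t := by
    rw [integral_finsetSum _ fun j hj => (hmom j (Finset.mem_range.1 hj)).const_mul _]
    obtain ⟨n, rfl⟩ : ∃ n, k = n + 1 := ⟨k - 1, by omega⟩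
    rw [Finset.sum_range_succ', Finset.sum_eq_zero]
    · simp [integral_const_mul, hK.integral_eq_one]
    · intro j hj
      rw [integral_const_mul, hKk.moment_eq_zero (j + 1) (by omega)
        (by simpa using hj), mul_zero]
  have hint : Integrable fun u => ∑ j ∈ Finset.range k, iteratedDeriv j f t / j.factorial * h ^ j *
      (u ^ j * K u) :=
    integrable_finsetSum _ fun j hj => (hmom j (Finset.mem_range.1 hj)).const_mul _
  have hbd : Integrable fun u => M * h ^ k * (|u| ^ k * |K u|) := by
    refine Integrable.const_mul ?_ _
    simpa [abs_mul] using hKk.integrable_moment.abs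
  have hmain : kernelMean K f h t - f t = ∫ u, (K u * f (t + h * u) -
      ∑ j ∈ Finset.range k, iteratedDeriv j f t / j.factorial * h ^ j * (u ^ j * K u)) := by
    rw [integral_sub (hK.integrable_mul hfk.continuous hf0 hfB h t) hint, hsum, kernelMean]
  have hle : |kernelMean K f h t - f t| ≤ ∫ u, M * h ^ k * (|u| ^ k * |K u|) := by
    rw [hmain, ← Real.norm_eq_abs]
    refine norm_integral_le_of_norm_le hbd (ae_of_all _ fun u => ?_)
    have h1 := abs_sub_taylor_le hk hfk hM t (h * u)
    rw [abs_mul, abs_of_nonneg hh, mul_pow] at h1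
    have h2 : K u * f (t + h * u) - ∑ j ∈ Finset.range k,
        iteratedDeriv j f t / j.factorial * h ^ j * (u ^ j * K u)
        = K u * (f (t + h * u) - ∑ j ∈ Finset.range k,
          iteratedDeriv j f t / j.factorial * (h * u) ^ j) := by
      rw [mul_sub, Finset.mul_sum]
      congr 1
      refine Finset.sum_congr rfl fun j _ => ?_
      rw [mul_pow]
      ring
    rw [h2, Real.norm_eq_abs, abs_mul]
    nlinarith [abs_nonneg (K u)]
  rw [integral_const_mul] at hle
  linarith

/-- For a nonnegative kernel, the density is controlled by the mean of its estimator, whatever the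
order of smoothness. -/
theorem IsKernel.exists_le_kernelMean_of_nonneg (hK : IsKernel K) (hK0 : ∀ u, 0 ≤ K u)
    (hk : 1 ≤ k) (hfk : ContDiff ℝ k f) (hM : ∀ t, |iteratedDeriv k f t| ≤ M)
    (hf0 : ∀ t, 0 ≤ f t) (hfB : ∀ t, f t ≤ B) :
    ∃ C : ℝ, 0 ≤ C ∧ ∀ h t : ℝ, 0 ≤ h → f t ≤ C * (kernelMean K f h t + h ^ k) := by
  -- These bounded sets, on which `K` is bounded below, exhaust `{K > 0}`. They cannot all be null,
  -- because the integral of `K` is one.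
  let A : ℕ → Set ℝ := fun m => {u | |u| ≤ m ∧ 1 / ((m : ℝ) + 1) ≤ K u}
  have hAm : ∀ m, MeasurableSet (A m) := fun m =>
    (measurableSet_le measurable_norm measurable_const).inter
      (measurableSet_le measurable_const hK.measurable)
  obtain ⟨m, hm⟩ : ∃ m, volume (A m) ≠ 0 := by
    by_contra! hall
    have h1 : volume (⋃ m, A m) = 0 := measure_iUnion_null hall
    have h2 : K =ᵐ[volume] 0 := by
      filter_upwards [measure_eq_zero_iff_ae_notMem.1 h1] with u hu
      by_contra hne
      have hpos : 0 < K u := lt_of_le_of_ne (hK0 u) (Ne.symm hne)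
      obtain ⟨m₁, h3⟩ := exists_nat_one_div_lt hpos
      obtain ⟨m₂, h4⟩ := exists_nat_ge |u|
      refine hu (Set.mem_iUnion.2 ⟨max m₁ m₂, ?_, ?_⟩)
      · exact h4.trans (by exact_mod_cast le_max_right _ _)
      · refine le_trans (one_div_le_one_div_of_le (by positivity) ?_) h3.le
        gcongr
        exact_mod_cast le_max_left _ _
    have h3 := hK.integral_eq_one
    rw [integral_congr_ae h2] at h3
    simp at h3
  obtain ⟨C, hC0, hC⟩ := exists_abs_le_setIntegral_abs hk hfk hM (hAm m) (fun u hu => hu.1) hm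
  refine ⟨C * (m + 1), by positivity, fun h t hh => ?_⟩
  have hfc := hfk.continuous
  have hi := hK.integrable_mul hfc hf0 hfB h t
  have h1 : ∫ u in A m, |f (t + h * u)| ≤ (m + 1) * kernelMean K f h t := by
    calc ∫ u in A m, |f (t + h * u)| ≤ ∫ u in A m, (m + 1) * (K u * f (t + h * u)) := by
          refine setIntegral_mono_on (Continuous.integrableOn_of_abs_le (by fun_prop)
            fun u hu => hu.1) (hi.const_mul _).integrableOn (hAm m) fun u hu => ?_
          rw [abs_of_nonneg (hf0 _), ← mul_assoc]
          refine le_mul_of_one_le_left (hf0 _) ?_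
          have := hu.2
          rw [div_le_iff₀ (by positivity)] at this
          linarith
      _ ≤ ∫ u, (m + 1) * (K u * f (t + h * u)) :=
          setIntegral_le_integral (hi.const_mul _) (ae_of_all _ fun u =>
            mul_nonneg (by positivity) (mul_nonneg (hK0 u) (hf0 _)))
      _ = _ := by rw [integral_const_mul, kernelMean]
  have h2 : h ^ k ≤ (m + 1) * h ^ k :=
    le_mul_of_one_le_left (by positivity) (by linarith [Nat.cast_nonneg (α := ℝ) m])
  calc f t ≤ |f t| := le_abs_self _
    _ ≤ _ := hC t h hh
    _ ≤ C * ((m + 1) * kernelMean K f h t + (m + 1) * h ^ k) := by gcongr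
    _ = _ := by ring

/-- The common form of the key inequality under either condition on the kernel. The positive part is
taken because a kernel of higher order may give a negative mean. -/
theorem IsKernel.exists_le_kernelMean (hK : IsKernel K)
    (hKk : (∀ u, 0 ≤ K u) ∨ HasKernelOrder K k)
    (hk : 1 ≤ k) (hfk : ContDiff ℝ k f) (hM : ∀ t, |iteratedDeriv k f t| ≤ M)
    (hf0 : ∀ t, 0 ≤ f t) (hfB : ∀ t, f t ≤ B) :
    ∃ C : ℝ, 0 ≤ C ∧ ∀ h t : ℝ, 0 ≤ h → f t ≤ C * (max (kernelMean K f h t) 0 + h ^ k) := by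
  rcases hKk with hK0 | hKk
  · obtain ⟨C, hC0, hC⟩ := hK.exists_le_kernelMean_of_nonneg hK0 hk hfk hM hf0 hfB
    exact ⟨C, hC0, fun h t hh => (hC h t hh).trans (by gcongr; exact le_max_left _ _)⟩
  · have hM0 : 0 ≤ M := (abs_nonneg _).trans (hM 0)
    set D := M * ∫ u, |u| ^ k * |K u|
    have hD : 0 ≤ D := mul_nonneg hM0 (integral_nonneg fun u => by positivity)
    refine ⟨1 + D, by positivity, fun h t hh => ?_⟩
    have h1 := (abs_le.1 (hKk.abs_kernelMean_sub_le hK hk hfk hM hf0 hfB hh t)).1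
    have h2 := le_max_left (kernelMean K f h t) 0
    have h3 := le_max_right (kernelMean K f h t) 0
    nlinarith [mul_nonneg hD h3, pow_nonneg hh k]

end KernelMean

/-! ### Consequences of the bandwidth condition. -/

section Rates

variable {h e : ℕ → ℝ} {k : ℕ}

theorem eventually_bandwidth_le
    (hC : (fun n : ℕ => h n ^ k + Real.log n / (n * h n)) =O[atTop] (fun n => e n ^ 2))
    (hh : ∀ n, 0 < h n) : ∃ c : ℝ, 0 ≤ c ∧
      ∀ᶠ n : ℕ in atTop, h n ^ k ≤ c * e n ^ 2 ∧ Real.log n / (n * h n) ≤ c * e n ^ 2 := by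
  obtain ⟨c, hc0, hc⟩ := hC.exists_nonneg
  refine ⟨c, hc0, hc.bound.mono fun n hn => ?_⟩
  have h1 : 0 ≤ h n ^ k := (pow_pos (hh n) k).le
  have h2 : 0 ≤ Real.log n / (n * h n) :=
    div_nonneg (Real.log_natCast_nonneg n) (mul_nonneg (Nat.cast_nonneg n) (hh n).le)
  rw [Real.norm_eq_abs, Real.norm_eq_abs, abs_of_nonneg (add_nonneg h1 h2),
    abs_of_nonneg (sq_nonneg _)] at hn
  exact ⟨by linarith, by linarith⟩

theorem tendsto_bandwidth
    (hC : (fun n : ℕ => h n ^ k + Real.log n / (n * h n)) =O[atTop] (fun n => e n ^ 2))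
    (hh : ∀ n, 0 < h n) (hk : 1 ≤ k) (he0 : Tendsto e atTop (𝓝 0)) :
    Tendsto h atTop (𝓝 0) := by
  obtain ⟨c, -, hc⟩ := eventually_bandwidth_le hC hh
  have h1 : Tendsto (fun n => c * e n ^ 2) atTop (𝓝 0) := by
    simpa using (he0.pow 2).const_mul c
  have h2 : Tendsto (fun n => h n ^ k) atTop (𝓝 0) :=
    squeeze_zero' (Eventually.of_forall fun n => (pow_pos (hh n) k).le)
      (hc.mono fun n hn => hn.1) h1
  have hk0 : (0 : ℝ) < (k : ℝ)⁻¹ := by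
    have : (0 : ℝ) < k := by exact_mod_cast hk
    positivity
  have h3 := h2.rpow_const (p := (k : ℝ)⁻¹) (Or.inr hk0.le)
  rw [Real.zero_rpow hk0.ne'] at h3
  refine h3.congr fun n => ?_
  exact Real.pow_rpow_inv_natCast (hh n).le (by omega)

/-- Dropping the factor `log n` from `log n / (n h) = O(e²)` turns `O` into `o`. -/
theorem tendsto_inv_mul_bandwidth_mul_sq
    (hC : (fun n : ℕ => h n ^ k + Real.log n / (n * h n)) =O[atTop] (fun n => e n ^ 2))
    (hh : ∀ n, 0 < h n) (he : ∀ n, 0 < e n) :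
    Tendsto (fun n : ℕ => 1 / (n * h n) / e n ^ 2) atTop (𝓝 0) := by
  obtain ⟨c, -, hc⟩ := eventually_bandwidth_le hC hh
  have hlog : Tendsto (fun n : ℕ => Real.log n) atTop atTop :=
    Real.tendsto_log_atTop.comp tendsto_natCast_atTop_atTop
  refine squeeze_zero' (g := fun n : ℕ => c / Real.log n)
    (Eventually.of_forall fun n => by have := hh n; positivity) ?_ (hlog.const_div_atTop c)
  filter_upwards [hc, hlog.eventually_gt_atTop 0] with n hn hl
  have h1 := sq_pos_of_pos (he n)
  rw [div_le_div_iff₀ h1 hl]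
  calc 1 / (n * h n) * Real.log n = Real.log n / (n * h n) := by ring
    _ ≤ _ := hn.2

theorem tendsto_deviation_bound_div
    (hC : (fun n : ℕ => h n ^ k + Real.log n / (n * h n)) =O[atTop] (fun n => e n ^ 2))
    (hh : ∀ n, 0 < h n) (he : ∀ n, 0 < e n) (he0 : Tendsto e atTop (𝓝 0)) (a b : ℝ) :
    Tendsto (fun n : ℕ => (a / (n * h n) + √(b / (n * h n))) / e n) atTop (𝓝 0) := by
  have h1 := tendsto_inv_mul_bandwidth_mul_sq hC hh he
  have h2 := ((h1.mul he0).const_mul a).add ((h1.const_mul b).sqrt)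
  simp only [mul_zero, Real.sqrt_zero, add_zero] at h2
  refine h2.congr fun n => ?_
  -- The linear term is `1 / (n h e²)` times `e`, and the root term is the square root of a multiple
  -- of `1 / (n h e²)`.
  have hen := he n
  rw [add_div]
  congr 1
  · field_simp
  · rw [← mul_div_assoc, Real.sqrt_div' _ (sq_nonneg _), Real.sqrt_sq hen.le, mul_one_div]

end Rates

/-! ### Deterministic part of the weight error. -/

theorem ae_eq_zero_of_support_le {f f₀ : ℝ → ℝ}
    (hsupp : Function.support f₀ ≤ᵐ[volume] Function.support f) :
    ∀ᵐ t, f t = 0 → f₀ t = 0 := by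
  filter_upwards [hsupp] with t ht h0
  by_contra h
  exact ht h h0

/-- The importance weights based on the trimmed mean of the density estimator converge in `L¹(F)`
to the exact importance weights. -/
theorem tendsto_lintegral_weight_sub {F F₀ : Measure ℝ} [IsProbabilityMeasure F₀]
    {f f₀ : ℝ → ℝ} (hf : IsDensityOf f F) (hf₀ : IsDensityOf f₀ F₀)
    (hsupp : Function.support f₀ ≤ᵐ[volume] Function.support f)
    {e : ℕ → ℝ} (he : ∀ n, 0 < e n) (he0 : Tendsto e atTop (𝓝 0))
    {g : ℕ → ℝ → ℝ} (hgm : ∀ n, Measurable (g n))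
    (hg : ∀ t, Tendsto (fun n => g n t) atTop (𝓝 (f t)))
    {C : ℝ} (hfC : ∀ᶠ n in atTop, ∀ t, f t ≤ C * max (g n t) (e n)) :
    Tendsto (fun n => ∫⁻ t, ENNReal.ofReal |f₀ t / max (g n t) (e n) - f₀ t / f t| ∂F)
      atTop (𝓝 0) := by
  have hm : ∀ n, Measurable fun t => ENNReal.ofReal |f₀ t / max (g n t) (e n) - f₀ t / f t| := by
    intro n
    exact (measurable_norm.comp ((hf₀.measurable.div ((hgm n).max measurable_const)).sub
      (hf₀.measurable.div hf.measurable))).ennreal_ofReal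
  have hpos : ∀ n t, 0 < max (g n t) (e n) := fun n t => lt_max_of_lt_right (he n)
  simp_rw [hf.lintegral_eq (hm _)]
  have hlim : Tendsto (fun n => ∫⁻ t, ENNReal.ofReal (f t) *
      ENNReal.ofReal |f₀ t / max (g n t) (e n) - f₀ t / f t|) atTop (𝓝 (∫⁻ t : ℝ, 0)) := by
    -- In the dominating function, `C` bounds `f / max (g n) (e n)` and `1` bounds `f / f`, also
    -- where `f` vanishes.
    refine tendsto_lintegral_filter_of_dominated_convergence
      (fun t => ENNReal.ofReal ((C + 1) * f₀ t))
      (Eventually.of_forall fun n => hf.measurable.ennreal_ofReal.mul (hm n)) ?_ ?_ ?_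
    · filter_upwards [hfC] with n hn
      refine ae_of_all _ fun t => ?_
      rw [← ENNReal.ofReal_mul (hf.nonneg t)]
      refine ENNReal.ofReal_le_ofReal ?_
      have h0 := hf₀.nonneg t
      have h1 := hf.nonneg t
      calc f t * |f₀ t / max (g n t) (e n) - f₀ t / f t|
          ≤ f t * (|f₀ t / max (g n t) (e n)| + |f₀ t / f t|) := by
            gcongr; exact abs_sub _ _
        _ = f₀ t * (f t / max (g n t) (e n)) + f₀ t * (f t / f t) := by
            rw [abs_of_nonneg (div_nonneg h0 (hpos n t).le), abs_of_nonneg (div_nonneg h0 h1)]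
            ring
        _ ≤ f₀ t * C + f₀ t * 1 := by
            gcongr
            · exact (div_le_iff₀ (hpos n t)).2 (hn t)
            · exact div_self_le_one _
        _ = _ := by ring
    · have h1 := (hf₀.integrable.const_mul (C + 1)).lintegral_lt_top
      exact h1.ne
    · filter_upwards [ae_eq_zero_of_support_le hsupp] with t ht
      by_cases h0 : f t = 0
      · simp [h0]
      · have h1 : Tendsto (fun n => max (g n t) (e n)) atTop (𝓝 (f t)) := by
          simpa [max_eq_left (hf.nonneg t)] using (hg t).max he0
        have h2 : Tendsto (fun n => |f₀ t / max (g n t) (e n) - f₀ t / f t|) atTop (𝓝 0) := by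
          have := ((tendsto_const_nhds (x := f₀ t).div h1 h0).sub_const (f₀ t / f t)).abs
          simpa using this
        have h3 := ENNReal.Tendsto.const_mul (a := ENNReal.ofReal (f t))
          (ENNReal.tendsto_ofReal h2) (Or.inr ENNReal.ofReal_ne_top)
        simpa using h3
  simpa using hlim

/-! ### Mean absolute deviation of the kernel estimator. -/

/-- The mean absolute deviation is at most the standard deviation. -/
theorem integral_abs_le_sqrt_variance {Ω : Type*} [MeasurableSpace Ω] {P : Measure Ω}
    [IsProbabilityMeasure P] {Z : Ω → ℝ} (hZ : MemLp Z 2 P) (hZ0 : ∫ ω, Z ω ∂P = 0) :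
    ∫ ω, |Z ω| ∂P ≤ √(Var[Z; P]) := by
  refine Real.le_sqrt_of_sq_le ?_
  -- The variance of `|Z|` is nonnegative, so `(E|Z|)² ≤ E Z² = Var Z`.
  have h1 := variance_eq_sub hZ
  have h2 := variance_eq_sub hZ.norm
  have h3 := variance_nonneg (fun ω => ‖Z ω‖) P
  simp only [Pi.pow_apply, Real.norm_eq_abs, sq_abs] at h1 h2 h3
  rw [hZ0] at h1
  linarith

section Deviation

variable {K f : ℝ → ℝ} {F : Measure ℝ} {B CK : ℝ}

/-- Substitution `y = t + h u`. -/
theorem kernelMean_eq_integral (hf : IsDensityOf f F) {h : ℝ} (hh : 0 < h) (t : ℝ) :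
    kernelMean K f h t = ∫ y, K ((y - t) / h) / h ∂F := by
  rw [hf.integral_eq, kernelMean]
  have h1 := integral_add_right_eq_self (μ := volume)
    (fun y => f y * (K ((y - t) / h) / h)) t
  rw [← h1]
  have h2 := Measure.integral_comp_mul_left (fun y => f (y + t) * (K ((y + t - t) / h) / h)) h
  rw [abs_of_pos (inv_pos.2 hh), smul_eq_mul] at h2
  rw [eq_inv_mul_iff_mul_eq₀ hh.ne', ← integral_const_mul] at h2
  rw [← h2]
  refine integral_congr_ae (ae_of_all _ fun u => ?_)
  simp only [add_sub_cancel_right, mul_div_cancel_left₀ u hh.ne']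
  rw [add_comm t]
  field_simp

theorem measurable_kernelMean (hK : Measurable K) (hf : Measurable f) (h : ℝ) :
    Measurable (kernelMean K f h) := by
  have : StronglyMeasurable (Function.uncurry fun t u => K u * f (t + h * u)) := by
    refine Measurable.stronglyMeasurable ?_
    exact (hK.comp measurable_snd).mul
      (hf.comp (measurable_fst.add (measurable_snd.const_mul h)))
  exact this.integral_prod_right'.measurable

variable {Ω : Type*} [MeasurableSpace Ω] {P : Measure Ω} [IsProbabilityMeasure P]
  {X : ℕ → Ω → ℝ}

/-- The second moment carries `1 / h²`, but the substitution `y = t + h u` absorbs one factor. One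
copy of `K` is then bounded by `CK` and the density by `B`. -/
theorem variance_kernel_le (hf : IsDensityOf f F) (hK : IsKernel K) (hKb : ∀ u, |K u| ≤ CK)
    (hfB : ∀ t, f t ≤ B) {Y : Ω → ℝ} (hY : Measurable Y)
    (hlaw : P.map Y = F) {h : ℝ} (hh : 0 < h) (t : ℝ) :
    Var[fun ω => K ((Y ω - t) / h) / h; P] ≤ B * CK * (∫ u, |K u|) / h := by
  have hCK : 0 ≤ CK := (abs_nonneg _).trans (hKb 0)
  have hm : Measurable fun y => K ((y - t) / h) / h :=
    (hK.measurable.comp ((measurable_id.sub_const t).div_const h)).div_const h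
  refine (variance_le_expectation_sq (hm.comp hY).aestronglyMeasurable).trans ?_
  have h1 : ∫ ω, ((fun ω => K ((Y ω - t) / h) / h) ^ 2) ω ∂P
      = ∫ y, K ((y - t) / h) ^ 2 / h / h ∂F := by
    rw [← hlaw, integral_map hY.aemeasurable]
    · refine integral_congr_ae (ae_of_all _ fun ω => ?_)
      simp only [Pi.pow_apply]
      field_simp
    · exact ((((hK.measurable.comp ((measurable_id.sub_const t).div_const h)).pow_const 2).div_const
        h).div_const h).aestronglyMeasurable
  -- The second moment is itself a kernel mean, for the kernel `K² / h`.
  have h2 := kernelMean_eq_integral (K := fun u => K u ^ 2 / h) hf hh t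
  refine h1.le.trans ?_
  rw [← h2, kernelMean, ← integral_const_mul, ← integral_div]
  refine integral_mono_of_nonneg
    (ae_of_all _ fun u => mul_nonneg (by positivity) (hf.nonneg _))
    ((hK.integrable.abs.const_mul _).div_const h) (ae_of_all _ fun u => ?_)
  have h3 := hfB (t + h * u)
  have h4 := hf.nonneg (t + h * u)
  calc K u ^ 2 / h * f (t + h * u) = |K u| * |K u| * f (t + h * u) / h := by
        rw [abs_mul_abs_self]; ring
    _ ≤ CK * |K u| * B / h := by gcongr; exact hKb u
    _ = _ := by ring

/-- The mean absolute deviation at `t` of a kernel density estimator computed from `n`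
observations, one of which is `t`. -/
theorem integral_abs_estimator_sub_le (hf : IsDensityOf f F) (hK : IsKernel K)
    (hKb : ∀ u, |K u| ≤ CK) (hB0 : 0 ≤ B) (hfB : ∀ t, f t ≤ B)
    (hXm : ∀ i, Measurable (X i)) (hXlaw : ∀ i, P.map (X i) = F) (hXindep : iIndepFun X P)
    {h : ℝ} (hh : 0 < h) {n : ℕ} (T : Finset ℕ) (hT : T.card + 1 = n) (t : ℝ) :
    ∫ ω, |1 / (n * h) * (K 0 + ∑ j ∈ T, K ((X j ω - t) / h)) - kernelMean K f h t| ∂P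
      ≤ 2 * CK / (n * h) + √(B * CK * (∫ u, |K u|) / (n * h)) := by
  set g := kernelMean K f h t with hg
  set V := B * CK * (∫ u, |K u|) with hV
  have hn : (0 : ℝ) < n := by exact_mod_cast (by omega : 0 < n)
  have hm : Measurable fun y => K ((y - t) / h) / h :=
    (hK.measurable.comp ((measurable_id.sub_const t).div_const h)).div_const h
  have hb : ∀ y, |K ((y - t) / h) / h| ≤ CK / h := fun y => by
    rw [abs_div, abs_of_pos hh]
    gcongr
    exact hKb _
  let Y : ℕ → Ω → ℝ := fun j ω => K ((X j ω - t) / h) / h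
  have hYm : ∀ j, Measurable (Y j) := fun j => hm.comp (hXm j)
  have hY2 : ∀ j, MemLp (Y j) 2 P := fun j =>
    MemLp.of_bound (hYm j).aestronglyMeasurable (CK / h) (ae_of_all _ fun ω => hb _)
  have hYi : ∀ j, Integrable (Y j) P := fun j => (hY2 j).integrable one_le_two
  have hYE : ∀ j, ∫ ω, Y j ω ∂P = g := fun j => by
    rw [hg, kernelMean_eq_integral hf hh, ← hXlaw j,
      integral_map (hXm j).aemeasurable hm.aestronglyMeasurable]
  have hgb : |g| ≤ CK / h := by
    rw [← hYE 0, ← Real.norm_eq_abs]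
    have := norm_integral_le_of_norm_le_const (μ := P) (f := Y 0) (C := CK / h)
      (ae_of_all _ fun ω => hb _)
    simpa using this
  let S : Ω → ℝ := ∑ j ∈ T, Y j
  have hS : MemLp S 2 P := memLp_finsetSum' T fun j _ => hY2 j
  have hSE : ∫ ω, S ω ∂P = T.card * g := by
    simp only [S, Finset.sum_apply]
    rw [integral_finsetSum _ fun j _ => hYi j]
    simp [hYE]
  have hSV : Var[S; P] ≤ T.card * (V / h) := by
    rw [IndepFun.variance_sum (fun j _ => hY2 j)]
    · rw [← nsmul_eq_mul]
      exact Finset.sum_le_card_nsmul _ _ _ fun j _ =>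
        variance_kernel_le hf hK hKb hfB (hXm j) (hXlaw j) hh t
    · intro i _ j _ hij
      exact (hXindep.indepFun hij).comp hm hm
  have hZ : MemLp (fun ω => S ω - T.card * g) 2 P := hS.sub (memLp_const _)
  have hZE : ∫ ω, (S ω - T.card * g) ∂P = 0 := by
    rw [integral_sub (hS.integrable one_le_two) (integrable_const _), hSE]
    simp
  have hZabs := integral_abs_le_sqrt_variance hZ hZE
  rw [variance_sub_const hS.aestronglyMeasurable] at hZabs
  have hT' : (T.card : ℝ) + 1 = n := by exact_mod_cast hT
  have hpt : ∀ ω, |1 / (n * h) * (K 0 + ∑ j ∈ T, K ((X j ω - t) / h)) - g|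
      ≤ 2 * CK / (n * h) + 1 / n * |S ω - T.card * g| := by
    intro ω
    -- The point `t` contributes its own term `K 0 / h`, whose distance to the mean is at most `2 CK
    -- / h`; the other `n - 1` terms form a centred independent sum.
    have h1 : 1 / (n * h) * (K 0 + ∑ j ∈ T, K ((X j ω - t) / h)) - g
        = 1 / n * (K 0 / h - g) + 1 / n * (S ω - T.card * g) := by
      have h2 : ∑ j ∈ T, K ((X j ω - t) / h) = h * S ω := by
        simp only [S, Y, Finset.sum_apply, Finset.mul_sum]
        exact Finset.sum_congr rfl fun j _ => by field_simp
      rw [h2, ← hT']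
      have : (T.card : ℝ) + 1 ≠ 0 := by positivity
      field_simp
      ring
    have h3 : |K 0 / h - g| ≤ CK / h + CK / h := by
      refine (abs_sub _ _).trans (add_le_add ?_ hgb)
      rw [abs_div, abs_of_pos hh]
      gcongr
      exact hKb 0
    rw [h1]
    refine (abs_add_le _ _).trans ?_
    rw [abs_mul, abs_mul, abs_of_pos (by positivity : 0 < 1 / (n : ℝ))]
    refine add_le_add ?_ le_rfl
    calc 1 / n * |K 0 / h - g| ≤ 1 / n * (CK / h + CK / h) := by gcongr
      _ = _ := by field_simp; ring
  have hZi : Integrable (fun ω => |S ω - T.card * g|) P := (hZ.integrable one_le_two).abs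
  refine (integral_mono_of_nonneg (ae_of_all _ fun ω => abs_nonneg _)
    ((integrable_const _).add (hZi.const_mul _)) (ae_of_all _ hpt)).trans ?_
  simp only [Pi.add_apply]
  rw [integral_add (integrable_const _) (hZi.const_mul _), integral_const_mul]
  simp only [integral_const, probReal_univ, one_smul]
  refine add_le_add le_rfl ?_
  have hV0 : 0 ≤ V := by
    have := (abs_nonneg _).trans (hKb 0)
    have : 0 ≤ ∫ u, |K u| := integral_nonneg fun u => abs_nonneg _
    positivity
  calc 1 / n * ∫ ω, |S ω - T.card * g| ∂P ≤ 1 / n * √(n * (V / h)) := by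
        gcongr
        refine hZabs.trans (Real.sqrt_le_sqrt (hSV.trans ?_))
        gcongr
        linarith
    _ = √(n * (V / h) / n ^ 2) := by
        rw [Real.sqrt_div' _ (sq_nonneg _), Real.sqrt_sq hn.le]
        ring
    _ = _ := by congr 1; field_simp

end Deviation

/-! ### Random part of the weight error. -/

/-- Trimming is 1-Lipschitz. Only the denominator with `a` (the random estimator) is lowered to `e`;
the one with `b` (its mean) is kept, to be cancelled later against `f`. -/
theorem abs_div_max_sub_div_max_le {c a b e : ℝ} (hc : 0 ≤ c) (he : 0 < e) :
    |c / max a e - c / max b e| ≤ c / (max b e * e) * |a - b| := by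
  have ha' : e ≤ max a e := le_max_right _ _
  have hb' : e ≤ max b e := le_max_right _ _
  have ha : 0 < max a e := he.trans_le ha'
  have hb : 0 < max b e := he.trans_le hb'
  have h1 : |max b e - max a e| ≤ |a - b| := by
    rw [abs_sub_comm a b]
    exact abs_max_sub_max_le_abs b a e
  have h2 : c / max a e - c / max b e = c / (max b e * max a e) * (max b e - max a e) := by
    field_simp
  rw [h2, abs_mul, abs_of_nonneg (by positivity)]
  gcongr

/-- The kernel density estimator at a data point, with the contribution of this point isolated. -/
theorem kernelEstimator_sample_self {Ω : Type*} (K : ℝ → ℝ) (h : ℝ) (X : ℕ → Ω → ℝ) {n : ℕ}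
    (i : Fin n) (ω : Ω) :
    kernelEstimator K h (sample X n ω) (sample X n ω i) = 1 / (n * h) *
      (K 0 + ∑ j ∈ (Finset.range n).erase i, K ((X j ω - X i ω) / h)) := by
  rw [kernelEstimator]
  congr 1
  have h1 := Finset.sum_range (n := n) fun j => K ((X j ω - X i ω) / h)
  simp only [sample]
  rw [← h1, ← Finset.add_sum_erase _ _ (Finset.mem_range.2 i.2)]
  simp

section Weights

variable {K f f₀ : ℝ → ℝ} {F F₀ : Measure ℝ} {B CK C : ℝ}
  {Ω : Type*} [MeasurableSpace Ω] {P : Measure Ω} [IsProbabilityMeasure P]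
  [IsProbabilityMeasure F₀] {X : ℕ → Ω → ℝ}

/-- Replacing the density estimator by its mean in the drawing weight of a data point costs little
in mean. -/
theorem lintegral_weight_mul_deviation_le (hf : IsDensityOf f F) (hf₀ : IsDensityOf f₀ F₀)
    (hK : IsKernel K) (hKb : ∀ u, |K u| ≤ CK) (hB0 : 0 ≤ B) (hfB : ∀ t, f t ≤ B)
    (hXm : ∀ i, Measurable (X i)) (hXlaw : ∀ i, P.map (X i) = F) (hXindep : iIndepFun X P)
    {h e : ℝ} (hh : 0 < h) (he : 0 < e)
    (hC : ∀ t, f t ≤ C * max (kernelMean K f h t) e) {n : ℕ} (i : Fin n) :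
    ∫⁻ ω, ENNReal.ofReal (f₀ (X i ω) / (max (kernelMean K f h (X i ω)) e * e) *
      |kernelEstimator K h (sample X n ω) (sample X n ω i) - kernelMean K f h (X i ω)|) ∂P
    ≤ ENNReal.ofReal
      (C * ((2 * CK / (n * h) + √(B * CK * (∫ u, |K u|) / (n * h))) / e)) := by
  set D := 2 * CK / (n * h) + √(B * CK * (∫ u, |K u|) / (n * h)) with hD
  set g := kernelMean K f h with hg
  have hgm : Measurable g := measurable_kernelMean hK.measurable hf.measurable h
  have hCK : 0 ≤ CK := (abs_nonneg _).trans (hKb 0)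
  have hD0 : 0 ≤ D := by positivity
  let T := (Finset.range n).erase i
  have hT : T.card + 1 = n := by
    rw [Finset.card_erase_add_one (Finset.mem_range.2 i.2), Finset.card_range]
  let W : ℝ → ℝ := fun t => f₀ t / (max (g t) e * e)
  have hW0 : ∀ t, 0 ≤ W t := fun t =>
    div_nonneg (hf₀.nonneg t) (mul_nonneg (he.le.trans (le_max_right _ _)) he.le)
  have hWm : Measurable W := hf₀.measurable.div ((hgm.max measurable_const).mul_const e)
  obtain ⟨S, hS⟩ : ∃ S : ℝ → (T → ℝ) → ℝ, ∀ t y, S t y =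
      |1 / (n * h) * (K 0 + ∑ j : T, K ((y j - t) / h)) - g t| := ⟨_, fun _ _ => rfl⟩
  have hSm : Measurable fun p : ℝ × (T → ℝ) => S p.1 p.2 := by
    simp only [hS]
    refine measurable_norm.comp (Measurable.sub (Measurable.const_mul
      (measurable_const.add (Finset.measurable_fun_sum _ fun j _ => ?_)) _)
      (hgm.comp measurable_fst))
    have h1 : Measurable fun p : ℝ × (T → ℝ) => p.2 j := (measurable_pi_apply j).comp measurable_snd
    exact hK.measurable.comp ((h1.sub measurable_fst).div_const h)
  let Y : Ω → T → ℝ := fun ω j => X j ω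
  have hYm : Measurable Y := measurable_pi_lambda _ fun j => hXm j
  -- Independence of `X i` from the other observations allows Fubini: the evaluation point is frozen
  -- at `t`, and the deviation bound holds uniformly in `t`.
  have hind : IndepFun (X i) Y P := by
    have h1 := hXindep.indepFun_finset {(i : ℕ)} T (by simp [T]) hXm
    have h2 : Measurable fun z : ({(i : ℕ)} : Finset ℕ) → ℝ => z ⟨i, Finset.mem_singleton_self _⟩ :=
      measurable_pi_apply _
    exact h1.comp h2 measurable_id
  let φ : ℝ × (T → ℝ) → ENNReal := fun p => ENNReal.ofReal (W p.1 * S p.1 p.2)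
  have hφ : Measurable φ := ((hWm.comp measurable_fst).mul hSm).ennreal_ofReal
  have hinner : ∀ t, ∫⁻ ω, ENNReal.ofReal (S t (Y ω)) ∂P ≤ ENNReal.ofReal D := by
    intro t
    have h1 := integral_abs_estimator_sub_le hf hK hKb hB0 hfB hXm hXlaw hXindep hh T hT t
    have h2 : ∀ ω, S t (Y ω)
        = |1 / (n * h) * (K 0 + ∑ j ∈ T, K ((X j ω - t) / h)) - g t| := by
      intro ω
      rw [hS, Finset.sum_coe_sort T fun j => K ((X j ω - t) / h)]
    have hmeas : Measurable fun ω => S t (Y ω) := hSm.comp (measurable_prodMk_left.comp hYm)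
    have hint : Integrable (fun ω => S t (Y ω)) P := by
      refine Integrable.of_bound hmeas.aestronglyMeasurable
        (1 / (n * h) * (CK + T.card * CK) + |g t|) (ae_of_all _ fun ω => ?_)
      rw [h2, Real.norm_eq_abs, abs_abs]
      refine (abs_sub _ _).trans (add_le_add ?_ le_rfl)
      rw [abs_mul, abs_of_nonneg (by positivity : 0 ≤ 1 / (n * h))]
      gcongr
      refine (abs_add_le _ _).trans (add_le_add (hKb 0) ?_)
      refine (Finset.abs_sum_le_sum_abs _ _).trans ?_
      rw [← nsmul_eq_mul]
      exact Finset.sum_le_card_nsmul _ _ _ fun j _ => hKb _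
    rw [← ofReal_integral_eq_lintegral_ofReal hint
      (ae_of_all _ fun ω => (abs_nonneg _).trans_eq (h2 ω).symm)]
    refine ENNReal.ofReal_le_ofReal ?_
    simp_rw [h2]
    exact h1
  calc _ = ∫⁻ ω, φ (X i ω, Y ω) ∂P := by
        refine lintegral_congr fun ω => ?_
        simp only [φ, W, hS, Y]
        rw [kernelEstimator_sample_self,
          Finset.sum_coe_sort T fun j => K ((X j ω - X i ω) / h)]
    _ = ∫⁻ p, φ p ∂(F.prod (P.map Y)) := by
        rw [← hXlaw i, ← hind.map_prod_eq_prod_map_map (hXm i).aemeasurable hYm.aemeasurable,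
          lintegral_map hφ ((hXm i).prodMk hYm)]
    _ = ∫⁻ t, ∫⁻ ω, φ (t, Y ω) ∂P ∂F := by
        have : IsProbabilityMeasure (P.map Y) := Measure.isProbabilityMeasure_map hYm.aemeasurable
        rw [lintegral_prod _ hφ.aemeasurable]
        refine lintegral_congr fun t => ?_
        exact lintegral_map (hφ.comp measurable_prodMk_left) hYm
    _ ≤ ∫⁻ t, ENNReal.ofReal (W t) * ENNReal.ofReal D ∂F := by
        refine lintegral_mono fun t => ?_
        simp only [φ, ENNReal.ofReal_mul (hW0 t)]
        rw [lintegral_const_mul' _ _ ENNReal.ofReal_ne_top]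
        gcongr
        exact hinner t
    _ = ∫⁻ t, ENNReal.ofReal (f t) * (ENNReal.ofReal (W t) * ENNReal.ofReal D) :=
        hf.lintegral_eq (hWm.ennreal_ofReal.mul_const _)
    _ ≤ ∫⁻ t, ENNReal.ofReal (f₀ t) * ENNReal.ofReal (C * (D / e)) := by
        refine lintegral_mono fun t => ?_
        rw [← ENNReal.ofReal_mul (hW0 t), ← ENNReal.ofReal_mul (hf.nonneg t),
          ← ENNReal.ofReal_mul (hf₀.nonneg t)]
        refine ENNReal.ofReal_le_ofReal ?_
        have hpos : 0 < max (g t) e := lt_max_of_lt_right he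
        have h0 := hf₀.nonneg t
        -- Integrating over the law of `X i` brings in `f`, which absorbs `max (g t) e`; one factor
        -- `1 / e` remains.
        calc f t * (W t * D) = f₀ t * ((f t / max (g t) e) * (D / e)) := by
              simp only [W]; field_simp
          _ ≤ _ := by
              gcongr
              exact (div_le_iff₀ hpos).2 (hC t)
    _ = _ := by
        rw [lintegral_mul_const _ hf₀.measurable.ennreal_ofReal, hf₀.lintegral_eq_one, one_mul]

/-- The drawing weight of a data point is close, in mean, to its exact importance weight. -/
theorem lintegral_drawWeight_sub_le (hf : IsDensityOf f F) (hf₀ : IsDensityOf f₀ F₀)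
    (hK : IsKernel K) (hKb : ∀ u, |K u| ≤ CK) (hB0 : 0 ≤ B) (hfB : ∀ t, f t ≤ B)
    (hXm : ∀ i, Measurable (X i)) (hXlaw : ∀ i, P.map (X i) = F) (hXindep : iIndepFun X P)
    {h e : ℝ} (hh : 0 < h) (he : 0 < e)
    (hC : ∀ t, f t ≤ C * max (kernelMean K f h t) e) {n : ℕ} (i : Fin n) :
    ∫⁻ ω, ENNReal.ofReal
      |drawWeight K f₀ h e (sample X n ω) i - f₀ (X i ω) / f (X i ω)| ∂P
    ≤ ENNReal.ofReal
      (C * ((2 * CK / (n * h) + √(B * CK * (∫ u, |K u|) / (n * h))) / e)) +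
      ∫⁻ t, ENNReal.ofReal |f₀ t / max (kernelMean K f h t) e - f₀ t / f t| ∂F := by
  have hgm : Measurable (kernelMean K f h) := measurable_kernelMean hK.measurable hf.measurable h
  have hm : Measurable fun t =>
      ENNReal.ofReal |f₀ t / max (kernelMean K f h t) e - f₀ t / f t| :=
    (measurable_norm.comp ((hf₀.measurable.div (hgm.max measurable_const)).sub
      (hf₀.measurable.div hf.measurable))).ennreal_ofReal
  rw [← hXlaw i, lintegral_map hm (hXm i)]
  refine le_trans ?_ (add_le_add_left (lintegral_weight_mul_deviation_le hf hf₀ hK hKb hB0 hfB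
    hXm hXlaw hXindep hh he hC i) _)
  refine le_trans ?_ (lintegral_add_right _ (hm.comp (hXm i))).le
  refine lintegral_mono fun ω => ?_
  refine le_trans (ENNReal.ofReal_le_ofReal ?_) ENNReal.ofReal_add_le
  refine (abs_sub_le _ (f₀ (X i ω) / max (kernelMean K f h (X i ω)) e) _).trans
    (add_le_add ?_ le_rfl)
  exact abs_div_max_sub_div_max_le (hf₀.nonneg _) he

end Weights

/-! ### Convergence in probability. -/

section InMeasure

variable {Ω : Type*} [MeasurableSpace Ω] {P : Measure Ω}

/-- The continuous mapping theorem for convergence in probability of pairs to a constant. -/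
theorem MeasureTheory.TendstoInMeasure.map₂_const {U V : ℕ → Ω → ℝ} {u v : ℝ} {φ : ℝ × ℝ → ℝ}
    (hU : TendstoInMeasure P U atTop fun _ => u) (hV : TendstoInMeasure P V atTop fun _ => v)
    (hφ : ContinuousAt φ (u, v)) :
    TendstoInMeasure P (fun n ω => φ (U n ω, V n ω)) atTop fun _ => φ (u, v) := by
  rw [tendstoInMeasure_iff_dist] at hU hV ⊢
  intro ε hε
  obtain ⟨δ, hδ, hδφ⟩ := Metric.continuousAt_iff.1 hφ ε hε
  have h1 := (hU δ hδ).add (hV δ hδ)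
  rw [add_zero] at h1
  refine tendsto_of_tendsto_of_tendsto_of_le_of_le tendsto_const_nhds h1 (fun n => zero_le)
    fun n => ?_
  refine (measure_mono fun ω hω => ?_).trans (measure_union_le _ _)
  by_contra hcon
  simp only [Set.mem_union, Set.mem_ofPred_eq, not_or, not_le] at hcon hω
  exact (hδφ (max_lt hcon.1 hcon.2)).not_ge hω

theorem MeasureTheory.TendstoInMeasure.of_abs_le {U Z : ℕ → Ω → ℝ}
    (hU : TendstoInMeasure P U atTop fun _ => 0) (hZ : ∀ᶠ n in atTop, ∀ ω, |Z n ω| ≤ |U n ω|) :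
    TendstoInMeasure P Z atTop fun _ => 0 := by
  rw [tendstoInMeasure_iff_dist] at hU ⊢
  intro ε hε
  refine tendsto_of_tendsto_of_tendsto_of_le_of_le' tendsto_const_nhds (hU ε hε)
    (Eventually.of_forall fun n => zero_le) (hZ.mono fun n hn => ?_)
  refine measure_mono fun ω hω => ?_
  simp only [Set.mem_ofPred_eq, Real.dist_eq, sub_zero] at hω ⊢
  exact hω.trans (hn ω)

theorem tendstoInMeasure_zero_of_lintegral {Z : ℕ → Ω → ℝ} (hZm : ∀ n, Measurable (Z n))
    (hZ : Tendsto (fun n => ∫⁻ ω, ENNReal.ofReal |Z n ω| ∂P) atTop (𝓝 0)) :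
    TendstoInMeasure P Z atTop fun _ => 0 := by
  refine tendstoInMeasure_of_tendsto_eLpNorm one_ne_zero
    (fun n => (hZm n).aestronglyMeasurable) aestronglyMeasurable_const ?_
  refine hZ.congr fun n => ?_
  rw [eLpNorm_one_eq_lintegral_enorm]
  refine lintegral_congr fun ω => ?_
  simp [← ofReal_norm]

end InMeasure

/-! ### Algebra of the resampling cdf. -/

section Resampling

variable {K f₀ : ℝ → ℝ} {h e : ℝ} {n : ℕ}

theorem drawWeight_nonneg (hf₀ : ∀ t, 0 ≤ f₀ t) (he : 0 < e) (z : Fin n → ℝ) (i : Fin n) :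
    0 ≤ drawWeight K f₀ h e z i :=
  div_nonneg (hf₀ _) (he.le.trans (le_max_right _ _))

/-- Only an inequality: if all drawing weights vanish, the normalized weights are `0` by the
convention for division by zero. -/
theorem sum_abs_normWeight_le_one (hf₀ : ∀ t, 0 ≤ f₀ t) (he : 0 < e) (z : Fin n → ℝ) :
    ∑ i, |normWeight K f₀ h e z i| ≤ 1 := by
  have h1 : ∀ i, |normWeight K f₀ h e z i| = drawWeight K f₀ h e z i /
      ∑ j, drawWeight K f₀ h e z j := fun i =>
    abs_of_nonneg (div_nonneg (drawWeight_nonneg hf₀ he z i)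
      (Finset.sum_nonneg fun j _ => drawWeight_nonneg hf₀ he z j))
  simp_rw [h1, ← Finset.sum_div]
  exact div_self_le_one _

theorem indLE_nonneg (x t : ℝ) : 0 ≤ indLE x t := Set.indicator_nonneg (by simp) t

theorem indLE_le_one (x t : ℝ) : indLE x t ≤ 1 :=
  Set.indicator_apply_le' (fun _ => le_rfl) fun _ => zero_le_one

theorem measurable_indLE (x : ℝ) : Measurable (indLE x) :=
  measurable_one.indicator measurableSet_Iic

theorem integral_indLE (μ : Measure ℝ) [IsProbabilityMeasure μ] (x : ℝ) :
    ∫ t, indLE x t ∂μ = cdf μ x := by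
  rw [cdf_eq_real]
  exact integral_indicator_one measurableSet_Iic

/-- The resampling cdf is stable under small changes of the weights and of the indicators. -/
theorem abs_resamplingCdf_sub_le (hf₀ : ∀ t, 0 ≤ f₀ t) (he : 0 < e) (z z' : Fin n → ℝ) (x : ℝ) :
    |resamplingCdf K f₀ h e z' x - resamplingCdf K f₀ h e z x| ≤
      n * (⨆ i, |normWeight K f₀ h e z i - normWeight K f₀ h e z' i|) +
      ⨆ i, |indLE x (z i) - indLE x (z' i)| := by
  set q := normWeight K f₀ h e z
  set q' := normWeight K f₀ h e z'
  set mq := ⨆ i, |q i - q' i|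
  set mI := ⨆ i, |indLE x (z i) - indLE x (z' i)|
  have hq : ∀ i, |q i - q' i| ≤ mq := fun i =>
    le_ciSup (f := fun i => |q i - q' i|) (Set.finite_range _).bddAbove i
  have hI : ∀ i, |indLE x (z i) - indLE x (z' i)| ≤ mI := fun i =>
    le_ciSup (f := fun i => |indLE x (z i) - indLE x (z' i)|) (Set.finite_range _).bddAbove i
  have hI0 : 0 ≤ mI := Real.iSup_nonneg fun i => abs_nonneg _
  -- The weights are changed first, against indicators at most one, at the cost of a factor `n`. The
  -- indicators are changed next, against weights `q` of total mass at most one, at no such cost.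
  have h1 : resamplingCdf K f₀ h e z' x - resamplingCdf K f₀ h e z x
      = ∑ i, (q' i - q i) * indLE x (z' i) + ∑ i, q i * (indLE x (z' i) - indLE x (z i)) := by
    simp only [resamplingCdf]
    rw [← Finset.sum_sub_distrib, ← Finset.sum_add_distrib]
    exact Finset.sum_congr rfl fun i _ => by ring
  rw [h1]
  refine (abs_add_le _ _).trans (add_le_add ?_ ?_)
  · calc _ ≤ ∑ i, |(q' i - q i) * indLE x (z' i)| := Finset.abs_sum_le_sum_abs _ _
      _ ≤ ∑ _i : Fin n, mq := by
        refine Finset.sum_le_sum fun i _ => ?_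
        rw [abs_mul, abs_of_nonneg (indLE_nonneg _ _), abs_sub_comm]
        exact (mul_le_of_le_one_right (abs_nonneg _) (indLE_le_one _ _)).trans (hq i)
      _ = n * mq := by simp
  · calc _ ≤ ∑ i, |q i * (indLE x (z' i) - indLE x (z i))| := Finset.abs_sum_le_sum_abs _ _
      _ ≤ ∑ i, |q i| * mI := by
        refine Finset.sum_le_sum fun i _ => ?_
        rw [abs_mul, abs_sub_comm]
        gcongr
        exact hI i
      _ ≤ 1 * mI := by
        rw [← Finset.sum_mul]
        gcongr
        exact sum_abs_normWeight_le_one hf₀ he z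
      _ = mI := one_mul _

/-- Both parts become weighted means of one shape, for the test functions `indLE x` and `1`; hence
the factor `1`. -/
theorem resamplingCdf_eq_div (z : Fin n → ℝ) (x : ℝ) :
    resamplingCdf K f₀ h e z x = ((∑ i, drawWeight K f₀ h e z i * indLE x (z i)) / n) /
      ((∑ i, drawWeight K f₀ h e z i * 1) / n) := by
  rcases Nat.eq_zero_or_pos n with rfl | hn
  · simp [resamplingCdf]
  have hn' : (n : ℝ) ≠ 0 := by exact_mod_cast hn.ne'
  rw [div_div_div_cancel_right₀ hn', Finset.sum_div]
  simp only [resamplingCdf, normWeight, mul_one]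
  exact Finset.sum_congr rfl fun i _ => by ring

end Resampling

/-! ### Limits of the weighted means. -/

section LargeSample

variable {Ω : Type*} [MeasurableSpace Ω] {P : Measure Ω} [IsProbabilityMeasure P]
  {F F₀ : Measure ℝ} [IsProbabilityMeasure F₀]
  {f f₀ K : ℝ → ℝ} {X : ℕ → Ω → ℝ} {h e : ℕ → ℝ}

theorem measurable_drawWeight_sample (hK : Measurable K) (hf₀ : Measurable f₀)
    (hXm : ∀ i, Measurable (X i)) (h e : ℝ) {n : ℕ} (i : Fin n) :
    Measurable fun ω => drawWeight K f₀ h e (sample X n ω) i := by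
  refine (hf₀.comp (hXm i)).div (Measurable.max (Measurable.const_mul
    (Finset.measurable_fun_sum _ fun j _ => ?_) _) measurable_const)
  exact hK.comp (((hXm j).sub (hXm i)).div_const h)

/-- The law of large numbers for exactly weighted observations. -/
theorem tendstoInMeasure_importance_mean (hf : IsDensityOf f F) (hf₀ : IsDensityOf f₀ F₀)
    (hsupp : Function.support f₀ ≤ᵐ[volume] Function.support f)
    (hXm : ∀ i, Measurable (X i)) (hXlaw : ∀ i, P.map (X i) = F) (hXindep : iIndepFun X P)
    {a : ℝ → ℝ} (ham : Measurable a) (ha : ∀ t, |a t| ≤ 1) :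
    TendstoInMeasure P (fun n ω => (∑ i ∈ Finset.range n, f₀ (X i ω) / f (X i ω) * a (X i ω)) / n)
      atTop fun _ => ∫ t, a t ∂F₀ := by
  let r : ℝ → ℝ := fun t => f₀ t / f t * a t
  have hrm : Measurable r := (hf₀.measurable.div hf.measurable).mul ham
  -- Where `f` vanishes the left side is `0`, and the support condition makes `f₀` vanish there
  -- almost everywhere. Without it, mass of `F₀` would be lost.
  have hae : ∀ᵐ t, f t * r t = f₀ t * a t := by
    filter_upwards [ae_eq_zero_of_support_le hsupp] with t ht
    by_cases h0 : f t = 0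
    · simp [h0, ht h0]
    · simp only [r]
      field_simp
  have hint : Integrable r F := by
    rw [hf.law_eq, integrable_withDensity_iff_integrable_smul' hf.measurable.ennreal_ofReal
      (ae_of_all _ fun _ => ENNReal.ofReal_lt_top)]
    simp only [ENNReal.toReal_ofReal (hf.nonneg _), smul_eq_mul]
    rw [integrable_congr hae]
    exact hf₀.integrable.mul_bdd ham.aestronglyMeasurable (ae_of_all _ ha)
  have hE : ∫ t, r t ∂F = ∫ t, a t ∂F₀ := by
    rw [hf.integral_eq, hf₀.integral_eq, integral_congr_ae hae]
  have hident : ∀ i, IdentDistrib (X i) (X 0) P P := fun i =>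
    ⟨(hXm i).aemeasurable, (hXm 0).aemeasurable, by rw [hXlaw, hXlaw]⟩
  have hslln := strong_law_ae_real (μ := P) (fun i => r ∘ X i)
    (by rw [← integrable_map_measure hrm.aestronglyMeasurable (hXm 0).aemeasurable, hXlaw]
        exact hint)
    (fun i j hij => (hXindep.indepFun hij).comp hrm hrm)
    (fun i => (hident i).comp hrm)
  have h0 : ∫ ω, (r ∘ X 0) ω ∂P = ∫ t, a t ∂F₀ := by
    rw [← hE, ← hXlaw 0, integral_map (hXm 0).aemeasurable hrm.aestronglyMeasurable]
    rfl
  rw [h0] at hslln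
  refine tendstoInMeasure_of_tendsto_ae (fun n => ?_) hslln
  exact ((Finset.measurable_fun_sum _ fun i _ => hrm.comp (hXm i)).div_const _).aestronglyMeasurable

variable {k : ℕ}

/-- The drawing weights are asymptotically equivalent, in mean, to the exact importance weights. -/
theorem tendstoInMeasure_mean_abs_drawWeight_sub [IsProbabilityMeasure F]
    (hf : IsDensityOf f F) (hf₀ : IsDensityOf f₀ F₀)
    (hXm : ∀ i, Measurable (X i)) (hXlaw : ∀ i, P.map (X i) = F) (hXindep : iIndepFun X P)
    (hk : 1 ≤ k) (hfk : ContDiff ℝ k f) {M : ℝ} (hM : ∀ t, |iteratedDeriv k f t| ≤ M)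
    (hK : IsKernel K) (hKk : (∀ u, 0 ≤ K u) ∨ HasKernelOrder K k)
    (hh : ∀ n, 0 < h n) (he : ∀ n, 0 < e n) (he0 : Tendsto e atTop (𝓝 0))
    (hC : (fun n : ℕ => h n ^ k + Real.log n / (n * h n)) =O[atTop] (fun n => e n ^ 2))
    (hsupp : Function.support f₀ ≤ᵐ[volume] Function.support f) :
    TendstoInMeasure P (fun n ω => (∑ i : Fin n,
      |drawWeight K f₀ (h n) (e n) (sample X n ω) i - f₀ (X i ω) / f (X i ω)|) / n)
      atTop fun _ => 0 := by
  obtain ⟨B, hB0, hfB⟩ := hf.exists_le hk hfk hM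
  obtain ⟨CK, hKb⟩ := hK.bounded
  obtain ⟨C₁, hC₁, hfC₁⟩ := hK.exists_le_kernelMean hKk hk hfk hM hf.nonneg hfB
  obtain ⟨c, hc0, hc⟩ := eventually_bandwidth_le hC hh
  -- The key inequality: once `e n < 1`, the remainder `h n ^ k ≤ c * e n ^ 2` is at most `c * e n`,
  -- which the trimming level absorbs.
  have hfC : ∀ᶠ n in atTop, ∀ t,
      f t ≤ (C₁ * (1 + c)) * max (kernelMean K f (h n) t) (e n) := by
    filter_upwards [hc, he0.eventually_lt_const zero_lt_one] with n hn hen t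
    have h1 : h n ^ k ≤ c * e n :=
      hn.1.trans (mul_le_mul_of_nonneg_left (by nlinarith [he n]) hc0)
    calc f t ≤ C₁ * (max (kernelMean K f (h n) t) 0 + h n ^ k) := hfC₁ _ t (hh n).le
      _ ≤ C₁ * (max (kernelMean K f (h n) t) (e n) +
          c * max (kernelMean K f (h n) t) (e n)) := by
        gcongr
        · exact (he n).le
        · exact h1.trans (mul_le_mul_of_nonneg_left (le_max_right _ _) hc0)
      _ = _ := by ring
  have hm : ∀ (n : ℕ) (i : Fin n), Measurable fun ω =>
      |drawWeight K f₀ (h n) (e n) (sample X n ω) i - f₀ (X i ω) / f (X i ω)| := fun n i =>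
    measurable_norm.comp ((measurable_drawWeight_sample hK.measurable hf₀.measurable hXm _ _ i).sub
      ((hf₀.measurable.div hf.measurable).comp (hXm i)))
  refine tendstoInMeasure_zero_of_lintegral
    (fun n => (Finset.measurable_fun_sum _ fun i _ => hm n i).div_const _) ?_
  have hbias := tendsto_lintegral_weight_sub hf hf₀ hsupp he he0
    (fun n => measurable_kernelMean hK.measurable hf.measurable (h n))
    (fun t => hK.tendsto_kernelMean hfk.continuous hf.nonneg hfB
      (tendsto_bandwidth hC hh hk he0) t) hfC
  have hdev := ENNReal.tendsto_ofReal ((tendsto_deviation_bound_div hC hh he he0 (2 * CK)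
    (B * CK * ∫ u, |K u|)).const_mul (C₁ * (1 + c)))
  rw [mul_zero, ENNReal.ofReal_zero] at hdev
  have hsum := hdev.add hbias
  rw [add_zero] at hsum
  refine tendsto_of_tendsto_of_tendsto_of_le_of_le' tendsto_const_nhds hsum
    (Eventually.of_forall fun n => zero_le) ?_
  filter_upwards [hfC, eventually_gt_atTop 0] with n hn hn0
  have hn1 : (n : ENNReal) ≠ 0 := by exact_mod_cast hn0.ne'
  calc _ = ∫⁻ ω, (∑ i : Fin n, ENNReal.ofReal
          |drawWeight K f₀ (h n) (e n) (sample X n ω) i - f₀ (X i ω) / f (X i ω)|)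
            * (n : ENNReal)⁻¹ ∂P := by
        refine lintegral_congr fun ω => ?_
        rw [abs_of_nonneg (div_nonneg (Finset.sum_nonneg fun i _ => abs_nonneg _)
          (Nat.cast_nonneg n)), ENNReal.ofReal_div_of_pos (by exact_mod_cast hn0),
          ENNReal.ofReal_sum_of_nonneg fun i _ => abs_nonneg _, ENNReal.ofReal_natCast,
          div_eq_mul_inv]
    _ = (∑ i : Fin n, ∫⁻ ω, ENNReal.ofReal
          |drawWeight K f₀ (h n) (e n) (sample X n ω) i - f₀ (X i ω) / f (X i ω)| ∂P)
            * (n : ENNReal)⁻¹ := by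
        rw [lintegral_mul_const _ (Finset.measurable_fun_sum _ fun i _ =>
          (hm n i).ennreal_ofReal), lintegral_finsetSum _ fun i _ => (hm n i).ennreal_ofReal]
    _ ≤ (n * (ENNReal.ofReal (C₁ * (1 + c) * ((2 * CK / (n * h n) +
          √(B * CK * (∫ u, |K u|) / (n * h n))) / e n)) + ∫⁻ t, ENNReal.ofReal
            |f₀ t / max (kernelMean K f (h n) t) (e n) - f₀ t / f t| ∂F)) * (n : ENNReal)⁻¹ := by
        -- The bound on the error of one weight does not depend on `i`, so it also bounds their
        -- mean.
        gcongr
        refine (Finset.sum_le_card_nsmul _ _ _ fun i _ => lintegral_drawWeight_sub_le hf hf₀ hK hKb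
          hB0 hfB hXm hXlaw hXindep (hh n) (he n) hn i).trans ?_
        rw [Finset.card_univ, Fintype.card_fin, nsmul_eq_mul]
    _ = _ := by
        rw [mul_comm, ← mul_assoc, ENNReal.inv_mul_cancel hn1 (ENNReal.natCast_ne_top n), one_mul]

/-- Weighted means with the drawing weights converge to the mean under the target law. -/
theorem tendstoInMeasure_drawWeight_mean (hf : IsDensityOf f F) (hf₀ : IsDensityOf f₀ F₀)
    (hsupp : Function.support f₀ ≤ᵐ[volume] Function.support f)
    (hXm : ∀ i, Measurable (X i)) (hXlaw : ∀ i, P.map (X i) = F) (hXindep : iIndepFun X P)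
    (hdev : TendstoInMeasure P (fun n ω => (∑ i : Fin n,
      |drawWeight K f₀ (h n) (e n) (sample X n ω) i - f₀ (X i ω) / f (X i ω)|) / n)
      atTop fun _ => 0)
    {a : ℝ → ℝ} (ham : Measurable a) (ha : ∀ t, |a t| ≤ 1) :
    TendstoInMeasure P (fun n ω => (∑ i : Fin n,
      drawWeight K f₀ (h n) (e n) (sample X n ω) i * a (sample X n ω i)) / n)
      atTop fun _ => ∫ t, a t ∂F₀ := by
  have hlln := tendstoInMeasure_importance_mean hf hf₀ hsupp hXm hXlaw hXindep ham ha
  have hdiff : TendstoInMeasure P (fun n ω => (∑ i : Fin n,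
      (drawWeight K f₀ (h n) (e n) (sample X n ω) i - f₀ (X i ω) / f (X i ω)) * a (X i ω)) / n)
      atTop fun _ => 0 := by
    refine hdev.of_abs_le (Eventually.of_forall fun n ω => ?_)
    rw [abs_div, abs_div]
    refine div_le_div_of_nonneg_right ?_ (abs_nonneg _)
    rw [abs_of_nonneg (Finset.sum_nonneg fun i _ => abs_nonneg
      (drawWeight K f₀ (h n) (e n) (sample X n ω) i - f₀ (X i ω) / f (X i ω)))]
    refine (Finset.abs_sum_le_sum_abs _ _).trans (Finset.sum_le_sum fun i _ => ?_)
    rw [abs_mul]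
    exact mul_le_of_le_one_right (abs_nonneg _) (ha _)
  have hadd := hlln.map₂_const hdiff (φ := fun p => p.1 + p.2) continuous_add.continuousAt
  simp only [add_zero] at hadd
  refine hadd.congr_left fun n => ae_of_all _ fun ω => ?_
  simp only [Finset.sum_range, sample]
  rw [← add_div, ← Finset.sum_add_distrib]
  congr 1
  exact Finset.sum_congr rfl fun i _ => by ring

end LargeSample

/-! ### Passage from the original to the augmented data. -/

theorem proposition2 {Ω : Type*} [MeasurableSpace Ω] (P : Measure Ω) [IsProbabilityMeasure P]
    -- the law `F` of the observations, the target law `F₀`, and their densities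
    (F F₀ : Measure ℝ) [IsProbabilityMeasure F] [IsProbabilityMeasure F₀]
    (f f₀ : ℝ → ℝ) (hf : IsDensityOf f F) (hf₀ : IsDensityOf f₀ F₀)
    -- the iid observations
    (X : ℕ → Ω → ℝ) (hXm : ∀ i, Measurable (X i)) (hXlaw : ∀ i, P.map (X i) = F)
    (hXindep : iIndepFun X P)
    -- the augmented data obtained from the first `n` observations
    (X' : (n : ℕ) → Ω → Fin n → ℝ) (hX'm : ∀ n, Measurable (X' n))
    -- smoothness, kernel, bandwidth and trimming sequence
    (k : ℕ) (hk : 1 ≤ k) (hfk : ContDiff ℝ k f)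
    (hfkb : ∃ M : ℝ, ∀ t, |iteratedDeriv k f t| ≤ M)
    (K : ℝ → ℝ) (hK : IsKernel K) (hKk : (∀ u, 0 ≤ K u) ∨ HasKernelOrder K k)
    (h e : ℕ → ℝ) (hh : ∀ n, 0 < h n) (he : ∀ n, 0 < e n) (he0 : Tendsto e atTop (𝓝 0))
    (hC : (fun n : ℕ => h n ^ k + Real.log n / (n * h n)) =O[atTop] (fun n => e n ^ 2))
    -- the support of `F` contains that of `F₀`
    (hsupp : Function.support f₀ ≤ᵐ[volume] Function.support f)
    -- the indicators of the original and of the augmented data are close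
    (𝒳 : Set ℝ)
    (hC' : ∀ x ∈ 𝒳, IsLittleOInProb P
      (fun n ω => ⨆ i : Fin n, |indLE x (sample X n ω i) - indLE x (X' n ω i)|)
      (fun n => 1 / n))
    -- the weights of the original and of the augmented data are close
    (hC'' : IsLittleOInProb P
      (fun n ω => ⨆ i : Fin n, |normWeight K f₀ (h n) (e n) (sample X n ω) i
        - normWeight K f₀ (h n) (e n) (X' n ω) i|)
      (fun n => 1 / n)) :
    ∀ x ∈ 𝒳, TendstoInMeasure P
      (fun n ω => resamplingCdf K f₀ (h n) (e n) (X' n ω) x) atTop (fun _ => cdf F₀ x) := by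
  obtain ⟨M, hM⟩ := hfkb
  intro x hx
  have hdev := tendstoInMeasure_mean_abs_drawWeight_sub hf hf₀ hXm hXlaw hXindep hk hfk hM hK hKk
    hh he he0 hC hsupp
  have hnum := tendstoInMeasure_drawWeight_mean hf hf₀ hsupp hXm hXlaw hXindep hdev
    (measurable_indLE x) fun t => by
      rw [abs_of_nonneg (indLE_nonneg x t)]
      exact indLE_le_one x t
  have hden := tendstoInMeasure_drawWeight_mean hf hf₀ hsupp hXm hXlaw hXindep hdev
    (a := fun _ => 1) measurable_const fun t => by simp
  rw [integral_indLE] at hnum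
  simp only [integral_const, probReal_univ, one_smul] at hden
  have hratio := hnum.map₂_const hden (φ := fun p => p.1 / p.2)
    (continuousAt_fst.div continuousAt_snd one_ne_zero)
  simp only [div_one, ← resamplingCdf_eq_div] at hratio
  have hpert := hC''.map₂_const (hC' x hx) (φ := fun p => p.1 + p.2) continuous_add.continuousAt
  rw [add_zero] at hpert
  have hdiff : TendstoInMeasure P (fun n ω => resamplingCdf K f₀ (h n) (e n) (X' n ω) x
      - resamplingCdf K f₀ (h n) (e n) (sample X n ω) x) atTop fun _ => 0 := by
    refine hpert.of_abs_le ?_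
    filter_upwards [eventually_ge_atTop 1] with n hn ω
    refine (abs_resamplingCdf_sub_le hf₀.nonneg (he n) _ _ x).trans
      (le_trans ?_ (le_abs_self _))
    simp only [one_div, div_inv_eq_mul]
    rw [mul_comm]
    -- The indicator term enters the stability bound without a factor `n`; for `n ≥ 1` it is at most
    -- `n` times itself, the quantity in (C').
    refine add_le_add le_rfl (le_mul_of_one_le_right (Real.iSup_nonneg fun i => abs_nonneg _) ?_)
    exact_mod_cast hn
  have hfinal := hratio.map₂_const hdiff (φ := fun p => p.1 + p.2) continuous_add.continuousAt
  simpa using hfinal
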